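/- Let $\mathbb F_q$ be a finite field, let $n,m\ge 1$ and $r$ be integers with $\gcd(q,n)=1$ and $r^m\equiv 1 \pmod n$, and let $G=\langle a,b \mid a^n=b^m=e,\ ba=a^rb\rangle$ be the split metacyclic group, with $A=\langle a\rangle$ and $B=\langle b\rangle$. For a monic irreducible $f\mid x^n-1$ over $\mathbb F_q$ and an integer $k$, let $f^{(k)}$ be the minimal polynomial of $\beta^k$, where $\beta$ is a root of $f$. The group $B$ acts on the monic irreducible divisors of $x^n-1$ by $b^j.f=f^{(r^j)}$. Let $f_1,\dots,f_\omega$ be representatives of the orbits, $\alpha_i$ a root of $f_i$ in some extension of $\mathbb F_q$, $B_i$ the stabilizer of $f_i$, $s_i$ the size of its orbit, $h_i=b^{s_i}$ (a generator of $B_i$), and let $\theta_i:B_i\to\operatorname{Aut}(\mathbb F_q[\alpha_i])$ be the homomorphism with $\theta_i(h_i)(\alpha_i)=\alpha_i^{r^{s_i}}$. Let $R_i=\mathbb F_q[\alpha_i]*_{\theta_i}B_i$ be the skew group algebra, in which $g\lambda=\theta_i(g)(\lambda)g$ for $g\in B_i$, $\lambda\in\mathbb F_q[\alpha_i]$. Let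 $\tau_i:\mathbb F_qG\to \mathbf M_{s_i}(R_i)$ be the algebra homomorphism sending $a$ to $\operatorname{diag}(\alpha_i,\alpha_i^r,\dots,\alpha_i^{r^{s_i-1}})$ and $b$ to the matrix with ones in the positions $(j,j+1)$, $1\le j<s_i$, with $h_i$ in the position $(s_i,1)$, and with zeros elsewhere. Let $C\subset\mathbb F_qG$ be a left ideal, and for each $i$ let $L_i\subset R_i^{s_i}$ be the left $R_i$-submodule consisting of the rows of the matrices in $\tau_i(C)$. Let $I=\{i : L_i\ne 0\}$, and for $i\in I$ let - $K_i\subset\{1,\dots,s_i\}$ be the union of the supports of the elements of $L_i$; - $V_i=(\mathbb F_qA)\,g_i(a)$ be the cyclic code of length $n$ with generator polynomial $g_i(x)=(x^n-1)/\prod_{j\in K_i} f_i^{(r^{j-1})}(x)$; - $d_i$ be the minimum Hamming distance of $L_i$, viewed as an $\mathbb F_q[\alpha_i]$-linear code of length $s_i|B_i|=m$ by taking coordinates with respect to the elements of $B_i$ in each of the $s_i$ entries. Let $I=\{i_1,\dots,i_{|I|}\}$ be enumerated so that $d_{i_1}\le d_{i_2}\le\dots\le d_{i_{|I|}}$. Then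 the sum $V_{i_1}+\dots+V_{i_{|I|}}$ is direct, and $$ d(C)\ \ge\ \min_{1\le j\le |I|}\ \bigl\{\, d_{i_j}\cdot d(V_{i_1}\dotplus\dots\dotplus V_{i_j})\,\bigr\}, $$ where $d$ denotes the minimum Hamming distance (with $d(0)=\infty$ and $\min\emptyset=\infty$, so that the claim is trivial for $C=0$). -/

import Mathlib

open Polynomial

namespace Metacyclic

noncomputable section

/-! ### The group `⟨a, b ∣ a ^ n = b ^ m = e, b a = a ^ r b⟩` -/

/-- The cyclic group of order `n`, written multiplicatively. -/
abbrev Cyc (n : ℕ) : Type := Multiplicative (ZMod n)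

/-- The standard generator of the cyclic group of order `n`. -/
def gen (n : ℕ) : Cyc n := Multiplicative.ofAdd 1

theorem cast_pow_eq_one {n m : ℕ} {r : ℤ} (hr : r ^ m ≡ 1 [ZMOD n]) :
    ((r : ZMod n)) ^ m = 1 := by
  have := (ZMod.intCast_eq_intCast_iff (r ^ m) 1 n).2 hr
  simpa using this

/-- The residue `r` as a unit modulo `n`. -/
def unitOf {n m : ℕ} [NeZero m] {r : ℤ} (hr : r ^ m ≡ 1 [ZMOD n]) : (ZMod n)ˣ :=
  Units.ofPowEqOne (r : ZMod n) m (cast_pow_eq_one hr) (NeZero.ne m)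

/-- The action of `⟨b⟩` on `⟨a⟩` in which `b ^ k` sends `a` to `a ^ (r ^ k)`. -/
def twist {n m : ℕ} [NeZero m] {r : ℤ} (hr : r ^ m ≡ 1 [ZMOD n]) :
    Cyc m →* MulAut (Cyc n) where
  toFun x := (MulAutMultiplicative (ZMod n)).symm
    (AddAut.mulLeft (unitOf hr ^ (Multiplicative.toAdd x).val))
  map_one' := by simp
  map_mul' x y := by
    rw [← map_mul, ← map_mul, ← pow_add]
    congr 2
    rw [toAdd_mul, ZMod.val_add, ← pow_mod_natCard_aux]
where
  pow_mod_natCard_aux {k : ℕ} : unitOf hr ^ k = unitOf hr ^ (k % m) := by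
    conv_lhs => rw [← Nat.mod_add_div k m, pow_add, pow_mul]
    rw [unitOf, Units.pow_ofPowEqOne, one_pow, mul_one]

/-- The split metacyclic group `⟨a, b ∣ a ^ n = b ^ m = e, b a = a ^ r b⟩`, realised as the
semidirect product of the cyclic groups `⟨a⟩` of order `n` and `⟨b⟩` of order `m`. -/
abbrev MetaGroup {n m : ℕ} [NeZero m] {r : ℤ} (hr : r ^ m ≡ 1 [ZMOD n]) : Type :=
  SemidirectProduct (Cyc n) (Cyc m) (twist hr)

/-- The generator `a`. -/
def genA {n m : ℕ} [NeZero m] {r : ℤ} (hr : r ^ m ≡ 1 [ZMOD n]) : MetaGroup hr :=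
  SemidirectProduct.inl (gen n)

/-- The generator `b`. -/
def genB {n m : ℕ} [NeZero m] {r : ℤ} (hr : r ^ m ≡ 1 [ZMOD n]) : MetaGroup hr :=
  SemidirectProduct.inr (gen m)

theorem gen_pow (n k : ℕ) : gen n ^ k = Multiplicative.ofAdd (k : ZMod n) := by
  simp [gen, ← ofAdd_nsmul]

theorem gen_pow_val {n : ℕ} [NeZero n] (x : Cyc n) :
    gen n ^ (Multiplicative.toAdd x).val = x := by
  rw [gen_pow, ZMod.natCast_zmod_val, ofAdd_toAdd]

theorem gen_pow_self (n : ℕ) : gen n ^ n = 1 := by simp [gen_pow]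

/-- The defining relations hold. -/
theorem relations {n m : ℕ} [NeZero m] {r : ℤ} (hr : r ^ m ≡ 1 [ZMOD n]) :
    genA hr ^ n = 1 ∧ genB hr ^ m = 1 ∧ genB hr * genA hr = genA hr ^ r * genB hr := by
  refine ⟨?_, ?_, ?_⟩
  · rw [genA, ← map_pow, gen_pow_self, map_one]
  · rw [genB, ← map_pow, gen_pow_self, map_one]
  · have h1 : twist hr (gen m) (gen n) = gen n ^ r := by
      have h2 : unitOf hr ^ (Multiplicative.toAdd (gen m)).val = unitOf hr := by
        conv_rhs => rw [← pow_one (unitOf hr), twist.pow_mod_natCard_aux]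
        rw [gen, toAdd_ofAdd, ZMod.val_one_eq_one_mod]
      have h3 : twist hr (gen m) = (MulAutMultiplicative (ZMod n)).symm
          (AddAut.mulLeft (unitOf hr ^ (Multiplicative.toAdd (gen m)).val)) := rfl
      rw [h3, h2]
      have h4 : gen n ^ r = Multiplicative.ofAdd (r : ZMod n) := by
        simp [gen, ← ofAdd_zsmul]
      rw [h4]
      change Multiplicative.ofAdd ((unitOf hr : ZMod n) * 1) = _
      rw [mul_one]; rfl
    rw [genA, genB, ← map_zpow, ← h1, SemidirectProduct.inl_aut]
    simp

/-- Every element has the normal form `a ^ l * b ^ k`. -/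
theorem normal_form {n m : ℕ} [NeZero n] [NeZero m] {r : ℤ} (hr : r ^ m ≡ 1 [ZMOD n])
    (g : MetaGroup hr) :
    genA hr ^ (Multiplicative.toAdd g.left).val * genB hr ^ (Multiplicative.toAdd g.right).val
      = g := by
  rw [genA, genB, ← map_pow, ← map_pow, gen_pow_val, gen_pow_val,
    SemidirectProduct.inl_left_mul_inr_right]

/-! ### Hamming distance -/

/-- The minimum distance of a set `C` with respect to a weight `wt`: the least value of
`wt (x - y)` for distinct `x`, `y` in `C`; it is `⊤` when there are no such `x`, `y`. -/
def minDist {M : Type*} [AddGroup M] (wt : M → ℕ) (C : Set M) : ℕ∞ :=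
  ⨅ (x ∈ C) (y ∈ C) (_ : x ≠ y), (wt (x - y) : ℕ∞)

/-- The Hamming weight of an element of a group algebra. -/
def wt {F G : Type*} [Field F] (u : MonoidAlgebra F G) : ℕ := u.coeff.support.card

/-- The minimum distance of a left ideal of a group algebra. -/
def codeDist {F G : Type*} [Field F] [Group G] (C : Ideal (MonoidAlgebra F G)) : ℕ∞ :=
  minDist wt (C : Set (MonoidAlgebra F G))

/-! ### Divisors of `x ^ n - 1` and the action of `⟨b⟩` on them -/

/-- For an irreducible `f`, the `k`-reciprocal polynomial: the minimal polynomial of `β ^ k`, where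
`β` is a root of `f` (the choice of the root does not matter, see `reciprocal_eq`). -/
def reciprocal {F : Type*} [Field F] (k : ℤ) (f : F[X]) : F[X] :=
  minpoly F ((Classical.epsilon fun β : AlgebraicClosure F => aeval β f = 0) ^ k)

theorem minpoly_root_zpow {F : Type*} [Field F] {f : F[X]} [Fact (Irreducible f)]
    {K : Type*} [Field K] [Algebra F K] {α : K} (hα : aeval α f = 0) (k : ℤ) :
    minpoly F (α ^ k) = minpoly F (AdjoinRoot.root f ^ k) := by
  let φ : AdjoinRoot f →ₐ[F] K := AdjoinRoot.liftAlgHom f (Algebra.ofId F K) α hα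
  have hφ : φ (AdjoinRoot.root f) = α := AdjoinRoot.liftAlgHom_root ..
  rw [← minpoly.algHom_eq φ φ.toRingHom.injective, map_zpow₀, hφ]

theorem reciprocal_eq {F : Type*} [Field F] {f : F[X]} (hf : Irreducible f)
    {K : Type*} [Field K] [Algebra F K] {α : K} (hα : aeval α f = 0) (k : ℤ) :
    reciprocal k f = minpoly F (α ^ k) := by
  have hβ : aeval (Classical.epsilon fun β : AlgebraicClosure F => aeval β f = 0) f = 0 :=
    Classical.epsilon_spec (p := fun β : AlgebraicClosure F => aeval β f = 0)
      (IsAlgClosed.exists_aeval_eq_zero _ f (degree_pos_of_irreducible hf).ne')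
  have : Fact (Irreducible f) := ⟨hf⟩
  rw [reciprocal, minpoly_root_zpow hβ, minpoly_root_zpow hα]

/-- The monic irreducible divisors of `x ^ n - 1` over `F`. -/
def Factor (F : Type*) [Field F] (n : ℕ) : Type _ :=
  {f : F[X] // f.Monic ∧ Irreducible f ∧ f ∣ X ^ n - 1}

theorem Factor.exists_root {F : Type*} [Field F] {n : ℕ} (f : Factor F n) :
    ∃ β : AlgebraicClosure F, aeval β f.1 = 0 :=
  IsAlgClosed.exists_aeval_eq_zero _ f.1 (degree_pos_of_irreducible f.2.2.1).ne'

theorem Factor.root_pow {F : Type*} [Field F] {n : ℕ} (f : Factor F n)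
    {K : Type*} [Field K] [Algebra F K] {α : K} (hα : aeval α f.1 = 0) : α ^ n = 1 := by
  obtain ⟨c, hc⟩ := f.2.2.2
  have := congrArg (aeval α) hc
  rw [map_mul, hα, zero_mul] at this
  simpa [sub_eq_zero] using this

theorem zpow_congr {K : Type*} [Field K] {n : ℕ} [NeZero n] {α : K} (hα : α ^ n = 1) {k l : ℤ}
    (h : k ≡ l [ZMOD n]) : α ^ k = α ^ l := by
  obtain ⟨c, hc⟩ := h.dvd
  have h0 : α ≠ 0 := by
    rintro rfl
    simp [NeZero.ne n] at hα
  have hl : l = k + n * c := by linarith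
  rw [hl, zpow_add₀ h0, zpow_mul, zpow_natCast, hα, one_zpow, mul_one]

theorem pow_val_add {n m : ℕ} [NeZero m] {r : ℤ} (hr : r ^ m ≡ 1 [ZMOD n]) (x y : ZMod m) :
    r ^ (x + y).val ≡ r ^ x.val * r ^ y.val [ZMOD n] := by
  rw [ZMod.val_add, ← pow_add]
  conv_rhs => rw [← Nat.mod_add_div (x.val + y.val) m, pow_add, pow_mul]
  simpa using ((hr.pow ((x.val + y.val) / m)).mul_left (r ^ ((x.val + y.val) % m))).symm

theorem reciprocal_mem {F : Type*} [Field F] {n : ℕ} [NeZero n] (f : Factor F n) (k : ℤ) :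
    (reciprocal k f.1).Monic ∧ Irreducible (reciprocal k f.1) ∧
      reciprocal k f.1 ∣ X ^ n - 1 := by
  obtain ⟨β, hβ⟩ := f.exists_root
  rw [reciprocal_eq f.2.2.1 hβ]
  have hint : IsIntegral F (β ^ k) := Algebra.IsIntegral.isIntegral _
  refine ⟨minpoly.monic hint, minpoly.irreducible hint, minpoly.dvd _ _ ?_⟩
  have : (β ^ k) ^ n = 1 := by
    rw [← zpow_natCast, zpow_comm, zpow_natCast, f.root_pow hβ, one_zpow]
  simp [this]

theorem reciprocal_reciprocal {F : Type*} [Field F] {n : ℕ} [NeZero n] (f : Factor F n)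
    (k l : ℤ) : reciprocal k (reciprocal l f.1) = reciprocal (l * k) f.1 := by
  obtain ⟨β, hβ⟩ := f.exists_root
  have h : aeval (β ^ l) (reciprocal l f.1) = 0 := by
    rw [reciprocal_eq f.2.2.1 hβ]
    exact minpoly.aeval _ _
  rw [reciprocal_eq (reciprocal_mem f l).2.1 h, reciprocal_eq f.2.2.1 hβ, zpow_mul]

theorem reciprocal_congr {F : Type*} [Field F] {n : ℕ} [NeZero n] (f : Factor F n) {k l : ℤ}
    (h : k ≡ l [ZMOD n]) : reciprocal k f.1 = reciprocal l f.1 := by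
  obtain ⟨β, hβ⟩ := f.exists_root
  rw [reciprocal_eq f.2.2.1 hβ, reciprocal_eq f.2.2.1 hβ, zpow_congr (f.root_pow hβ) h]

/-- The action of `⟨b⟩` on the monic irreducible divisors of `x ^ n - 1`, in which `b ^ j` sends
`f` to its `r ^ j`-reciprocal polynomial. -/
@[reducible] def factorAction (F : Type*) [Field F] {n m : ℕ} [NeZero n] [NeZero m] {r : ℤ}
    (hr : r ^ m ≡ 1 [ZMOD n]) : MulAction (Cyc m) (Factor F n) where
  smul x f := ⟨reciprocal (r ^ (Multiplicative.toAdd x).val) f.1, reciprocal_mem f _⟩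
  one_smul f := by
    refine Subtype.ext ?_
    change reciprocal (r ^ (0 : ZMod m).val) f.1 = f.1
    obtain ⟨β, hβ⟩ := f.exists_root
    rw [ZMod.val_zero, pow_zero, reciprocal_eq f.2.2.1 hβ, zpow_one]
    exact (minpoly.eq_of_irreducible_of_monic f.2.2.1 hβ f.2.1).symm
  mul_smul x y f := by
    refine Subtype.ext ?_
    change reciprocal (r ^ (Multiplicative.toAdd x + Multiplicative.toAdd y).val) f.1
      = reciprocal (r ^ (Multiplicative.toAdd x).val)
        (reciprocal (r ^ (Multiplicative.toAdd y).val) f.1)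
    rw [reciprocal_reciprocal, add_comm]
    exact reciprocal_congr f (pow_val_add hr _ _)

section Orbit

variable {F : Type*} [Field F] {n m : ℕ} [NeZero n] [NeZero m] {r : ℤ}

/-- The orbit of `f` under `⟨b⟩`. -/
def orbit (hr : r ^ m ≡ 1 [ZMOD n]) (f : Factor F n) : Set (Factor F n) :=
  letI := factorAction F hr
  MulAction.orbit (Cyc m) f

/-- The size `s` of the orbit of `f`. -/
def orbitSize (hr : r ^ m ≡ 1 [ZMOD n]) (f : Factor F n) : ℕ := (orbit hr f).ncard

/-- The stabilizer of `f`, a subgroup of `⟨b⟩`. -/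
def stab (hr : r ^ m ≡ 1 [ZMOD n]) (f : Factor F n) : Subgroup (Cyc m) :=
  letI := factorAction F hr
  MulAction.stabilizer (Cyc m) f

/-- The family `f` lists one representative of each orbit. -/
def IsOrbitReps {ω : ℕ} (hr : r ^ m ≡ 1 [ZMOD n]) (f : Fin ω → Factor F n) : Prop :=
  ∀ g : Factor F n, ∃! i, g ∈ orbit hr (f i)

/-- The element `h = b ^ s` of the stabilizer of `f`. -/
def stabGen (hr : r ^ m ≡ 1 [ZMOD n]) (f : Factor F n) : stab hr f :=
  ⟨gen m ^ orbitSize hr f, by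
    let := factorAction F hr
    have h := Subgroup.pow_index_mem (MulAction.stabilizer (Cyc m) f) (gen m)
    rwa [MulAction.index_stabilizer] at h⟩

/-- `α` is a root of `f` and `K = F[α]`. -/
def IsRootField (f : Factor F n) {K : Type*} [Field K] [Algebra F K] (α : K) : Prop :=
  aeval α f.1 = 0 ∧ Algebra.adjoin F {α} = ⊤

theorem mem_stab_iff (hr : r ^ m ≡ 1 [ZMOD n]) (f : Factor F n) (x : Cyc m) :
    x ∈ stab hr f ↔ reciprocal (r ^ (Multiplicative.toAdd x).val) f.1 = f.1 :=
  ⟨fun h => congrArg Subtype.val h, fun h => Subtype.ext h⟩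

/-- For `b ^ j` in the stabilizer there is an automorphism of `F[α]` with `α ↦ α ^ (r ^ j)`. -/
theorem exists_aut (hr : r ^ m ≡ 1 [ZMOD n]) (f : Factor F n)
    {K : Type*} [Field K] [Algebra F K] {α : K} (hα : IsRootField f α) (x : stab hr f) :
    ∃ σ : K ≃ₐ[F] K, σ α = α ^ (r ^ (Multiplicative.toAdd x.1).val) := by
  have : Fact (Irreducible f.1) := ⟨f.2.2.1⟩
  have hx := (mem_stab_iff hr f x.1).1 x.2
  rw [reciprocal_eq f.2.2.1 hα.1] at hx
  have hroot : aeval (α ^ (r ^ (Multiplicative.toAdd x.1).val)) f.1 = 0 := by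
    conv_lhs => rw [← hx]
    exact minpoly.aeval _ _
  let φ : AdjoinRoot f.1 →ₐ[F] K := AdjoinRoot.liftAlgHom f.1 (Algebra.ofId F K) α hα.1
  let ψ : AdjoinRoot f.1 →ₐ[F] K := AdjoinRoot.liftAlgHom f.1 (Algebra.ofId F K) _ hroot
  have hφ : φ (AdjoinRoot.root f.1) = α := AdjoinRoot.liftAlgHom_root ..
  have hψ : ψ (AdjoinRoot.root f.1) = α ^ (r ^ (Multiplicative.toAdd x.1).val) :=
    AdjoinRoot.liftAlgHom_root ..
  have hsurj : Function.Surjective φ := by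
    rw [← AlgHom.range_eq_top, eq_top_iff, ← hα.2]
    refine Algebra.adjoin_le ?_
    rintro _ rfl
    exact ⟨_, hφ⟩
  let e : AdjoinRoot f.1 ≃ₐ[F] K := AlgEquiv.ofBijective φ ⟨φ.toRingHom.injective, hsurj⟩
  have : FiniteDimensional F (AdjoinRoot f.1) :=
    (AdjoinRoot.powerBasis f.2.2.1.ne_zero).finite
  have : FiniteDimensional F K := Module.Finite.equiv e.toLinearEquiv
  let σ : K →ₐ[F] K := ψ.comp e.symm.toAlgHom
  refine ⟨AlgEquiv.ofBijective σ (Algebra.IsAlgebraic.algHom_bijective σ), ?_⟩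
  change ψ (e.symm α) = _
  have : e.symm α = AdjoinRoot.root f.1 := by
    rw [AlgEquiv.symm_apply_eq]; exact hφ.symm
  rw [this, hψ]

theorem aut_ext {K : Type*} [Field K] [Algebra F K] {α : K}
    (hα : Algebra.adjoin F {α} = ⊤) {σ ρ : K ≃ₐ[F] K} (h : σ α = ρ α) : σ = ρ := by
  have : (σ : K →ₐ[F] K) = ρ := by
    refine AlgHom.ext_of_adjoin_eq_top hα ?_
    rintro _ rfl
    exact h
  ext y
  exact DFunLike.congr_fun this y

/-- The homomorphism `θ` from the stabilizer of `f` to the automorphism group of `F[α]`; the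
automorphism `θ (b ^ j)` is the one with `α ↦ α ^ (r ^ j)`, and `θ h` the one with
`α ↦ α ^ (r ^ s)`. -/
def theta (hr : r ^ m ≡ 1 [ZMOD n]) (f : Factor F n)
    {K : Type*} [Field K] [Algebra F K] {α : K} (hα : IsRootField f α) :
    stab hr f →* (K ≃ₐ[F] K) where
  toFun x := (exists_aut hr f hα x).choose
  map_one' := by
    refine aut_ext hα.2 ?_
    rw [(exists_aut hr f hα 1).choose_spec]
    simp
  map_mul' x y := by
    refine aut_ext hα.2 ?_
    rw [AlgEquiv.mul_apply, (exists_aut hr f hα (x * y)).choose_spec,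
      (exists_aut hr f hα y).choose_spec, map_zpow₀, (exists_aut hr f hα x).choose_spec,
      ← zpow_mul]
    exact zpow_congr (f.root_pow hα.1) (pow_val_add hr _ _)

theorem theta_apply (hr : r ^ m ≡ 1 [ZMOD n]) (f : Factor F n)
    {K : Type*} [Field K] [Algebra F K] {α : K} (hα : IsRootField f α) (x : stab hr f) :
    theta hr f hα x α = α ^ (r ^ (Multiplicative.toAdd x.1).val) :=
  (exists_aut hr f hα x).choose_spec

theorem theta_stabGen (hr : r ^ m ≡ 1 [ZMOD n]) (f : Factor F n)
    {K : Type*} [Field K] [Algebra F K] {α : K} (hα : IsRootField f α) :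
    theta hr f hα (stabGen hr f) α = α ^ (r ^ orbitSize hr f) := by
  rw [theta_apply]
  refine zpow_congr (f.root_pow hα.1) ?_
  have h : (Multiplicative.toAdd (stabGen hr f).1).val = orbitSize hr f % m := by
    change (Multiplicative.toAdd (gen m ^ orbitSize hr f)).val = _
    rw [gen_pow, toAdd_ofAdd, ZMod.val_natCast]
  rw [h]
  conv_rhs => rw [← Nat.mod_add_div (orbitSize hr f) m, pow_add, pow_mul]
  simpa using ((hr.pow (orbitSize hr f / m)).mul_left (r ^ (orbitSize hr f % m))).symm

end Orbit

/-! ### Skew group algebras -/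

/-- The skew group algebra `K *_θ G`, in which `g * c = θ g c * g` for `g ∈ G` and `c ∈ K`. -/
def SkewAlg {F K G : Type*} [Field F] [Field K] [Algebra F K] [Group G]
    (_θ : G →* (K ≃ₐ[F] K)) : Type _ := SkewMonoidAlgebra K G

section Skew

variable {F K G : Type*} [Field F] [Field K] [Algebra F K] [Group G] (θ : G →* (K ≃ₐ[F] K))

instance : Ring (SkewAlg θ) :=
  letI := MulSemiringAction.compHom K θ
  inferInstanceAs (Ring (SkewMonoidAlgebra K G))

instance : Module F (SkewAlg θ) :=
  letI := MulSemiringAction.compHom K θ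
  inferInstanceAs (Module F (SkewMonoidAlgebra K G))

/-- The element `c g` of `K *_θ G`. -/
def SkewAlg.single (g : G) (c : K) : SkewAlg θ := SkewMonoidAlgebra.single g c

theorem SkewAlg.single_mul_single (g g' : G) (c c' : K) :
    SkewAlg.single θ g c * SkewAlg.single θ g' c' =
      SkewAlg.single θ (g * g') (c * θ g c') :=
  letI := MulSemiringAction.compHom K θ
  SkewMonoidAlgebra.single_mul_single (k := K) (G := G)

variable {θ}

/-- The Hamming weight, over `K`, of the coordinate vector in `K ^ (l |G|)` of an element of
`(K *_θ G) ^ l`. Writing the elements of `K *_θ G` as `∑ g, c_g g` or as `∑ g, g c_g` gives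
the same weight, since `g c = θ g c * g`. -/
def coordWt {l : ℕ} (x : Fin l → SkewAlg θ) : ℕ :=
  ∑ j, (SkewMonoidAlgebra.support (x j : SkewMonoidAlgebra K G)).card

/-- The minimum distance of a submodule of `(K *_θ G) ^ l`, viewed as a linear code over `K` of
length `l |G|`. -/
def coordDist {l : ℕ} (L : Submodule (SkewAlg θ) (Fin l → SkewAlg θ)) : ℕ∞ :=
  minDist coordWt (L : Set (Fin l → SkewAlg θ))

/-- The union of the supports of the elements of a submodule of `R ^ l`. -/
def suppSubmodule {R : Type*} [Ring R] {l : ℕ} (L : Submodule R (Fin l → R)) : Set (Fin l) :=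
  {j | ∃ x ∈ L, x j ≠ 0}

/-- The left ideal of the matrices all of whose rows lie in `L`. -/
def rowIdeal {R : Type*} [Ring R] {l : ℕ} (L : Submodule R (Fin l → R)) :
    Set (Matrix (Fin l) (Fin l) R) :=
  {M | ∀ j, M j ∈ L}

end Skew

/-! ### The decomposition of the group algebra and of metacyclic codes -/

section Decomposition

variable {F : Type*} [Field F] {n m : ℕ} [NeZero n] [NeZero m] {r : ℤ}
  {K : Type*} [Field K] [Algebra F K] {α : K}

/-- The coefficient ring `F[α] *_θ Stab(f)`. -/
abbrev CoeffRing (hr : r ^ m ≡ 1 [ZMOD n]) (f : Factor F n) (hα : IsRootField f α) : Type _ :=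
  SkewAlg (theta hr f hα)

/-- The matrix `diag(α, α ^ r, …, α ^ (r ^ (s - 1)))`. -/
def matA (hr : r ^ m ≡ 1 [ZMOD n]) (f : Factor F n) (hα : IsRootField f α) :
    Matrix (Fin (orbitSize hr f)) (Fin (orbitSize hr f)) (CoeffRing hr f hα) :=
  Matrix.diagonal fun j => SkewAlg.single _ 1 (α ^ (r ^ j.val))

/-- The matrix with ones just above the diagonal, `h` in the lower left corner, and zeros
elsewhere (the `1 × 1` matrix `h` when `s = 1`). -/
def matB (hr : r ^ m ≡ 1 [ZMOD n]) (f : Factor F n) (hα : IsRootField f α) :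
    Matrix (Fin (orbitSize hr f)) (Fin (orbitSize hr f)) (CoeffRing hr f hα) :=
  Matrix.of fun j l =>
    if j.val + 1 = l.val then 1
    else if j.val + 1 = orbitSize hr f ∧ l.val = 0 then SkewAlg.single _ (stabGen hr f) 1
    else 0

/-- The component `τ_f` of the decomposition: the linear map with `a ^ l b ^ k ↦ A ^ l B ^ k`,
where `A` and `B` are the two matrices above. -/
def tau (hr : r ^ m ≡ 1 [ZMOD n]) (f : Factor F n) (hα : IsRootField f α)
    (P : MonoidAlgebra F (MetaGroup hr)) :
    Matrix (Fin (orbitSize hr f)) (Fin (orbitSize hr f)) (CoeffRing hr f hα) :=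
  P.coeff.sum fun g c =>
    c • (matA hr f hα ^ (Multiplicative.toAdd g.left).val *
      matB hr f hα ^ (Multiplicative.toAdd g.right).val)

/-- The component `L` of a left ideal `C` of the group algebra: the left submodule made of the rows
of the matrices in the image of `C` (`component_eq` shows that these are the submodules in the
decomposition of the image of `C`). -/
def component (hr : r ^ m ≡ 1 [ZMOD n]) (f : Factor F n) (hα : IsRootField f α)
    (C : Ideal (MonoidAlgebra F (MetaGroup hr))) :
    Submodule (CoeffRing hr f hα) (Fin (orbitSize hr f) → CoeffRing hr f hα) :=
  Submodule.span _ {x | ∃ P ∈ C, ∃ j, x = tau hr f hα P j}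

/-- The cyclic code `V ⊆ F[⟨a⟩]` of length `n` generated by
`(x ^ n - 1) / ∏ j ∈ S, f ^ (r ^ j)` (indices starting at `0`), where `f ^ (k)` is the
`k`-reciprocal polynomial. -/
def cyclicCode (hr : r ^ m ≡ 1 [ZMOD n]) (f : Factor F n) (S : Set (Fin (orbitSize hr f))) :
    Ideal (MonoidAlgebra F (Cyc n)) :=
  Ideal.span {aeval (MonoidAlgebra.of F (Cyc n) (gen n))
    (((X : F[X]) ^ n - 1) / ∏ j ∈ S.toFinite.toFinset, reciprocal (r ^ j.val) f.1)}

/-- If the image of `C` under `τ = (τ_i)_i` is the product of the left ideals belonging to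
submodules `L i`, then `L i` is the `i`-th component of `C`. -/
theorem component_eq {ω : ℕ} (hr : r ^ m ≡ 1 [ZMOD n]) (f : Fin ω → Factor F n)
    {K : Fin ω → Type*} [∀ i, Field (K i)] [∀ i, Algebra F (K i)] {α : ∀ i, K i}
    (hα : ∀ i, IsRootField (f i) (α i)) (C : Ideal (MonoidAlgebra F (MetaGroup hr)))
    (L : ∀ i, Submodule (CoeffRing hr (f i) (hα i))
      (Fin (orbitSize hr (f i)) → CoeffRing hr (f i) (hα i)))
    (hL : (fun P i => tau hr (f i) (hα i) P) '' (C : Set (MonoidAlgebra F (MetaGroup hr))) =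
      {M | ∀ i, M i ∈ rowIdeal (L i)}) (i : Fin ω) :
    component hr (f i) (hα i) C = L i := by
  refine le_antisymm (Submodule.span_le.2 ?_) fun x hx => ?_
  · rintro _ ⟨P, hP, j, rfl⟩
    exact (hL.subset ⟨P, hP, rfl⟩ : ∀ i, _) i j
  · rcases isEmpty_or_nonempty (Fin (orbitSize hr (f i))) with h | ⟨⟨j⟩⟩
    · rw [Subsingleton.elim x 0]
      exact Submodule.zero_mem _
    · let M : ∀ i, Matrix (Fin (orbitSize hr (f i))) (Fin (orbitSize hr (f i)))
        (CoeffRing hr (f i) (hα i)) := Function.update (fun _ => 0) i (Matrix.of fun _ => x)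
      have hMi : M i = Matrix.of fun _ => x := Function.update_self ..
      have hM : ∀ i', M i' ∈ rowIdeal (L i') := by
        intro i' j'
        rcases eq_or_ne i' i with rfl | h
        · rw [hMi]; exact hx
        · have : M i' = 0 := Function.update_of_ne h ..
          rw [this]; exact Submodule.zero_mem _
      obtain ⟨P, hP, hPM⟩ := hL.superset hM
      refine Submodule.subset_span ⟨P, hP, j, ?_⟩
      have h1 : tau hr (f i) (hα i) P = M i := congrFun hPM i
      rw [h1, hMi]
      rfl

end Decomposition

end

end Metacyclic

open Metacyclic

/-! Write a nonzero `P ∈ C` as `∑ y * Q_y` over `y ∈ ⟨b⟩` with slices `Q_y ∈ F[⟨a⟩]`; the weight of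
`P` is the sum of the weights of the `Q_y`. Two facts bound it from below.

The rows of `τ_i P` see the slices. With `y = b ^ k`, the slice `Q_y` contributes to row `j` only in
column `(j + k) % s`, at the group element `h ^ ((j + k) / s)`, with coefficient the value of `Q_y`
at `α ^ (r ^ (j + k))` (`tau_apply`). Distinct `y` occupy distinct coordinates, so a row has weight
at most the number of nonzero slices (`coordWt_tau_le`). If some slice does not vanish at a root
belonging to `f_i`, some row is a nonzero element of `L_i`, and at least `d_i` slices are nonzero.

The slices lie in a sum of cyclic codes. Since `b ^ k` stands on the left, the evaluation point is,
up to conjugacy, determined by the column, so a slice can be nonzero at `α_i ^ (r ^ l)` only for `l`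
in the support of `L_i`. As `x ^ n - 1` is squarefree, membership in an ideal of `F[⟨a⟩]` is decided
by vanishing at roots of unity (`mem_of_forall_cyclicCode_le`). Hence, if `j₀` is the last index
whose component sees a slice, every `Q_y` lies in the sum of the first `j₀` codes. Multiplying the
number of nonzero slices by the distance of this sum gives the bound. -/

namespace Metacyclic

/-! ### Orbits of `⟨b⟩` on the irreducible factors. -/

section OrbitFacts

variable {F : Type*} [Field F] {n m : ℕ} [NeZero n] [NeZero m] {r : ℤ}

theorem gen_pow_smul_val (hr : r ^ m ≡ 1 [ZMOD n]) (f : Factor F n) (k : ℕ) :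
    letI := factorAction F hr
    (gen m ^ k • f).1 = reciprocal (r ^ k) f.1 := by
  let := factorAction F hr
  change reciprocal (r ^ (Multiplicative.toAdd (gen m ^ k)).val) f.1 = _
  refine reciprocal_congr f ?_
  rw [gen_pow, toAdd_ofAdd, ZMod.val_natCast]
  conv_rhs => rw [← Nat.mod_add_div k m, pow_add, pow_mul]
  simpa using ((hr.pow (k / m)).mul_left (r ^ (k % m))).symm

/-- Holds because `b` generates the acting group. It makes arithmetic of exponents modulo the orbit
size available. -/
theorem orbitSize_eq_minimalPeriod (hr : r ^ m ≡ 1 [ZMOD n]) (f : Factor F n) :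
    letI := factorAction F hr
    orbitSize hr f = Function.minimalPeriod (gen m • ·) f := by
  let := factorAction F hr
  have htop : Subgroup.zpowers (gen m) = ⊤ := by
    rw [eq_top_iff]
    rintro x -
    exact ⟨(Multiplicative.toAdd x).val, (zpow_natCast _ _).trans (gen_pow_val x)⟩
  have horb : MulAction.orbit (Subgroup.zpowers (gen m)) f = MulAction.orbit (Cyc m) f := by
    ext g
    constructor
    · rintro ⟨x, rfl⟩
      exact ⟨x.1, rfl⟩
    · rintro ⟨x, rfl⟩
      exact ⟨⟨x, htop ▸ Subgroup.mem_top x⟩, rfl⟩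
  have : Finite (MulAction.orbit (Subgroup.zpowers (gen m)) f) :=
    Set.finite_range _
  let := Fintype.ofFinite (MulAction.orbit (Subgroup.zpowers (gen m)) f)
  rw [MulAction.minimalPeriod_eq_card, ← Nat.card_eq_fintype_card, horb]
  rfl

theorem orbitSize_pos (hr : r ^ m ≡ 1 [ZMOD n]) (f : Factor F n) : 0 < orbitSize hr f := by
  let := factorAction F hr
  exact (Set.ncard_pos (Set.finite_range _)).2 (MulAction.nonempty_orbit f)

theorem reciprocal_pow_mod (hr : r ^ m ≡ 1 [ZMOD n]) (f : Factor F n) (k : ℕ) :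
    reciprocal (r ^ (k % orbitSize hr f)) f.1 = reciprocal (r ^ k) f.1 := by
  let := factorAction F hr
  rw [← gen_pow_smul_val hr, ← gen_pow_smul_val hr, orbitSize_eq_minimalPeriod,
    MulAction.pow_smul_mod_minimalPeriod]

theorem reciprocal_pow_injOn (hr : r ^ m ≡ 1 [ZMOD n]) (f : Factor F n) {k l : ℕ}
    (hk : k < orbitSize hr f) (hl : l < orbitSize hr f)
    (h : reciprocal (r ^ k) f.1 = reciprocal (r ^ l) f.1) : k = l := by
  let := factorAction F hr
  rw [← gen_pow_smul_val hr, ← gen_pow_smul_val hr] at h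
  rw [orbitSize_eq_minimalPeriod] at hk hl
  have h' := Subtype.ext h
  rw [← smul_iterate_apply, ← smul_iterate_apply] at h'
  exact Function.iterate_injOn_Iio_minimalPeriod hk hl h'

theorem mem_orbit_iff (hr : r ^ m ≡ 1 [ZMOD n]) (f g : Factor F n) :
    g ∈ orbit hr f ↔ ∃ k : Fin (orbitSize hr f), g.1 = reciprocal (r ^ k.val) f.1 := by
  let := factorAction F hr
  constructor
  · rintro ⟨x, rfl⟩
    refine ⟨⟨(Multiplicative.toAdd x).val % orbitSize hr f, Nat.mod_lt _ (orbitSize_pos hr f)⟩, ?_⟩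
    rw [reciprocal_pow_mod]
    rfl
  · rintro ⟨k, hk⟩
    rw [← gen_pow_smul_val hr] at hk
    exact ⟨gen m ^ k.val, (Subtype.ext hk).symm⟩

end OrbitFacts

/-! ### Cyclic codes and their zeros. -/

section CyclicCodes

variable {F : Type*} [Field F] {n m : ℕ} [NeZero n] [NeZero m] {r : ℤ}
  {K : Type*} [Field K] [Algebra F K]

/-- Evaluation of an element of the group algebra of the cyclic group of order `n` at an `n`-th
root of unity. -/
noncomputable def cycEval (F : Type*) [Field F] {K : Type*} [Field K] [Algebra F K] {n : ℕ}
    [NeZero n] (β : K) (hβ : β ^ n = 1) : MonoidAlgebra F (Cyc n) →ₐ[F] K :=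
  MonoidAlgebra.lift F K (Cyc n)
    { toFun := fun v => β ^ (Multiplicative.toAdd v).val
      map_one' := by simp
      map_mul' := fun v w => by
        rw [toAdd_mul, ZMod.val_add, ← pow_eq_pow_mod _ hβ, pow_add] }

theorem cycEval_apply (β : K) (hβ : β ^ n = 1) (x : MonoidAlgebra F (Cyc n)) :
    cycEval F β hβ x = ∑ v, x.coeff v • β ^ (Multiplicative.toAdd v).val := by
  rw [cycEval, MonoidAlgebra.lift_apply, Finsupp.sum_fintype _ _ (by simp)]
  rfl

theorem cycEval_aeval (β : K) (hβ : β ^ n = 1) (q : F[X]) :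
    cycEval F β hβ (aeval (MonoidAlgebra.of F (Cyc n) (gen n)) q) = aeval β q := by
  rw [← aeval_algHom_apply]
  congr 2
  rw [cycEval, MonoidAlgebra.lift_of]
  change β ^ (1 : ZMod n).val = β
  rw [ZMod.val_one_eq_one_mod, ← pow_eq_pow_mod _ hβ, pow_one]

theorem aeval_gen_surjective :
    Function.Surjective (aeval (R := F) (MonoidAlgebra.of F (Cyc n) (gen n))) := by
  intro x
  induction x using MonoidAlgebra.induction_on with
  | of v =>
    refine ⟨X ^ (Multiplicative.toAdd v).val, ?_⟩
    rw [map_pow, aeval_X, ← map_pow, gen_pow_val]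
  | add x y hx hy =>
    obtain ⟨p, rfl⟩ := hx
    obtain ⟨q, rfl⟩ := hy
    exact ⟨p + q, map_add _ _ _⟩
  | smul c x hx =>
    obtain ⟨p, rfl⟩ := hx
    exact ⟨c • p, map_smul _ _ _⟩

omit [NeZero n] in
theorem aeval_gen_X_pow_sub_one :
    aeval (MonoidAlgebra.of F (Cyc n) (gen n)) (X ^ n - 1 : F[X]) = 0 := by
  rw [map_sub, map_pow, aeval_X, ← map_pow, gen_pow_self, map_one, map_one, sub_self]

omit [NeZero n] in
theorem zpow_pow_eq_one {β : K} (hβ : β ^ n = 1) (k : ℤ) : (β ^ k) ^ n = 1 := by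
  rw [← zpow_natCast, zpow_comm, zpow_natCast, hβ, one_zpow]

theorem cycEval_eq_zero_iff (f : Factor F n) {α : K} (hα : aeval α f.1 = 0) (k : ℤ) (q : F[X]) :
    cycEval F (α ^ k) (zpow_pow_eq_one (f.root_pow hα) k)
      (aeval (MonoidAlgebra.of F (Cyc n) (gen n)) q) = 0 ↔ reciprocal k f.1 ∣ q := by
  rw [cycEval_aeval, reciprocal_eq f.2.2.1 hα, minpoly.dvd_iff]

/-- Conjugate points have the same vanishing polynomials. This is needed because `α ^ (r ^ k)` and
`α ^ (r ^ (k % s))` are in general conjugate but not equal. -/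
theorem cycEval_eq_zero_iff_of_reciprocal_eq (f : Factor F n) {α : K} (hα : aeval α f.1 = 0)
    {k l : ℤ} (hkl : reciprocal k f.1 = reciprocal l f.1) (x : MonoidAlgebra F (Cyc n)) :
    cycEval F (α ^ k) (zpow_pow_eq_one (f.root_pow hα) k) x = 0 ↔
      cycEval F (α ^ l) (zpow_pow_eq_one (f.root_pow hα) l) x = 0 := by
  obtain ⟨q, rfl⟩ := aeval_gen_surjective x
  rw [cycEval_eq_zero_iff f hα, cycEval_eq_zero_iff f hα, hkl]

omit [NeZero n] in
-- The characteristic divides the order of `F`, so by coprimality it does not divide `n`, and `x ^ n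
-- - 1` is separable.
theorem squarefree_X_pow_sub_one [Finite F] (hq : Nat.Coprime (Nat.card F) n) :
    Squarefree (X ^ n - 1 : F[X]) := by
  refine (X_pow_sub_one_separable_iff.2 fun h => ?_).squarefree
  obtain ⟨p, hp⟩ := CharP.exists F
  have : Fact p.Prime := ⟨CharP.char_is_prime F p⟩
  have h1 : p ∣ n := (CharP.cast_eq_zero_iff F p n).1 h
  have h2 : p ∣ Nat.card F := by
    have := Fintype.ofFinite F
    rw [← CharP.cast_eq_zero_iff F p, Nat.card_eq_fintype_card, Nat.cast_card_eq_zero]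
  exact (CharP.char_is_prime F p).one_lt.ne'
    (Nat.eq_one_of_dvd_one (hq ▸ Nat.dvd_gcd h2 h1))

theorem eq_of_irreducible_dvd {p q : F[X]} (hp : Irreducible p) (hq : Irreducible q)
    (hpm : p.Monic) (hqm : q.Monic) (h : p ∣ q) : p = q :=
  eq_of_monic_of_associated hpm hqm (hp.associated_of_dvd hq h)

/-- Exponents below the orbit size give distinct monic irreducible polynomials, hence pairwise
coprime divisors. -/
theorem prod_reciprocal_dvd (hr : r ^ m ≡ 1 [ZMOD n]) (f : Factor F n)
    (S : Finset (Fin (orbitSize hr f))) :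
    ∏ j ∈ S, reciprocal (r ^ j.val) f.1 ∣ X ^ n - 1 := by
  refine Finset.prod_dvd_of_coprime ?_ fun j _ => (reciprocal_mem f _).2.2
  intro j _ l _ hjl
  refine (reciprocal_mem f _).2.1.coprime_iff_not_dvd.2 fun h => hjl ?_
  exact Fin.ext (reciprocal_pow_injOn hr f j.2 l.2 (eq_of_irreducible_dvd (reciprocal_mem f _).2.1
    (reciprocal_mem f _).2.1 (reciprocal_mem f _).1 (reciprocal_mem f _).1 h))

theorem prod_reciprocal_mul_div (hr : r ^ m ≡ 1 [ZMOD n]) (f : Factor F n)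
    (S : Finset (Fin (orbitSize hr f))) :
    (∏ j ∈ S, reciprocal (r ^ j.val) f.1) *
      ((X ^ n - 1) / ∏ j ∈ S, reciprocal (r ^ j.val) f.1) = X ^ n - 1 :=
  EuclideanDomain.mul_div_cancel'
    (Finset.prod_ne_zero_iff.2 fun _ _ => (reciprocal_mem f _).1.ne_zero)
    (prod_reciprocal_dvd hr f S)

/-- A divisor of `x ^ n - 1` divides every polynomial having all its irreducible factors. -/
theorem dvd_of_forall_reciprocal_dvd [Finite F] (hq : Nat.Coprime (Nat.card F) n)
    (hr : r ^ m ≡ 1 [ZMOD n]) {ω : ℕ} (f : Fin ω → Factor F n) (hf : IsOrbitReps hr f)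
    {g q : F[X]} (hg : g ∣ X ^ n - 1)
    (h : ∀ i (l : Fin (orbitSize hr (f i))), reciprocal (r ^ l.val) (f i).1 ∣ g →
      reciprocal (r ^ l.val) (f i).1 ∣ q) : g ∣ q := by
  have hrad : (Ideal.span {g}).IsRadical :=
    isRadical_iff_span_singleton.1 ((squarefree_X_pow_sub_one hq).squarefree_of_dvd hg).isRadical
  have hX : (X ^ n - 1 : F[X]) ≠ 0 := X_pow_sub_C_ne_zero (NeZero.pos n) 1
  have hg0 : g ≠ 0 := ne_zero_of_dvd_ne_zero hX hg
  -- A radical ideal is the intersection of the primes above it, so it suffices to treat one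
  -- irreducible factor of `g` at a time.
  rw [← Ideal.mem_span_singleton, ← hrad.radical, Ideal.radical_eq_sInf, Submodule.mem_sInf]
  classical
  rintro P ⟨hgP, hP⟩
  obtain ⟨p, rfl⟩ := (IsPrincipalIdealRing.principal P).principal
  rw [Ideal.submodule_span_eq] at hgP hP ⊢
  have hpg : p ∣ g := Ideal.span_singleton_le_span_singleton.1 hgP
  have hp0 : p ≠ 0 := ne_zero_of_dvd_ne_zero hg0 hpg
  have hp : Irreducible p := ((Ideal.span_singleton_prime hp0).1 hP).irreducible
  have hass : Associated (normalize p) p := normalize_associated p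
  obtain ⟨i, hi, -⟩ := hf ⟨normalize p, monic_normalize hp0, hass.symm.irreducible hp,
    hass.dvd.trans (hpg.trans hg)⟩
  obtain ⟨l, hl⟩ := (mem_orbit_iff hr _ _).1 hi
  change normalize p = _ at hl
  have := h i l
  rw [← hl] at this
  rw [Ideal.mem_span_singleton]
  exact hass.symm.dvd.trans (this (hass.dvd.trans hpg))

/-- An element of the group algebra belongs to an ideal as soon as each root of unity at which it
does not vanish is among the roots belonging to a cyclic code inside the ideal. -/
theorem mem_of_forall_cyclicCode_le [Finite F] (hq : Nat.Coprime (Nat.card F) n)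
    (hr : r ^ m ≡ 1 [ZMOD n]) {ω : ℕ} (f : Fin ω → Factor F n) (hf : IsOrbitReps hr f)
    {K : Fin ω → Type*} [∀ i, Field (K i)] [∀ i, Algebra F (K i)] {α : ∀ i, K i}
    (hα : ∀ i, aeval (α i) (f i).1 = 0) (S : ∀ i, Set (Fin (orbitSize hr (f i))))
    (J : Ideal (MonoidAlgebra F (Cyc n))) (x : MonoidAlgebra F (Cyc n))
    (h : ∀ i (l : Fin (orbitSize hr (f i))),
      cycEval F (α i ^ (r ^ l.val)) (zpow_pow_eq_one ((f i).root_pow (hα i)) _) x ≠ 0 →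
      cyclicCode hr (f i) (S i) ≤ J ∧ l ∈ S i) : x ∈ J := by
  obtain ⟨q, rfl⟩ := aeval_gen_surjective x
  let φ := (aeval (R := F) (MonoidAlgebra.of F (Cyc n) (gen n))).toRingHom
  -- `g` is the generator polynomial of `J`; the claim becomes `g ∣ q`.
  obtain ⟨g, hg⟩ := (IsPrincipalIdealRing.principal (J.comap φ)).principal
  have hmem : ∀ p : F[X], aeval (MonoidAlgebra.of F (Cyc n) (gen n)) p ∈ J ↔ g ∣ p := by
    intro p
    rw [← Ideal.mem_span_singleton, ← Ideal.submodule_span_eq, ← hg]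
    rfl
  have hgX : g ∣ X ^ n - 1 := by
    rw [← hmem, aeval_gen_X_pow_sub_one]
    exact J.zero_mem
  rw [hmem]
  refine dvd_of_forall_reciprocal_dvd hq hr f hf hgX fun i l hl => ?_
  by_contra hlq
  obtain ⟨hV, hlS⟩ := h i l fun h0 => hlq ((cycEval_eq_zero_iff (f i) (hα i) _ q).1 h0)
  have hgi := (hmem _).1 (hV (Ideal.subset_span rfl))
  -- A factor of `g` not dividing `q` would divide both the product over `S i` and, through `g`, the
  -- complementary generator polynomial; its square would then divide `x ^ n - 1`.
  have h1 := Finset.dvd_prod_of_mem (fun j : Fin (orbitSize hr (f i)) =>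
    reciprocal (r ^ j.val) (f i).1) ((S i).toFinite.mem_toFinset.2 hlS)
  have h2 := mul_dvd_mul h1 (hl.trans hgi)
  rw [prod_reciprocal_mul_div] at h2
  exact (reciprocal_mem (f i) _).2.1.not_isUnit (squarefree_X_pow_sub_one hq _ h2)

/-- An irreducible divisor of `x ^ n - 1` outside the removed product must divide the generator
polynomial of the code. -/
theorem cycEval_eq_zero_of_mem_cyclicCode (hr : r ^ m ≡ 1 [ZMOD n]) (f g : Factor F n)
    {α : K} (hα : aeval α g.1 = 0) (S : Set (Fin (orbitSize hr f))) (k : ℤ)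
    (h : ∀ l ∈ S, reciprocal k g.1 ≠ reciprocal (r ^ l.val) f.1)
    {x : MonoidAlgebra F (Cyc n)} (hx : x ∈ cyclicCode hr f S) :
    cycEval F (α ^ k) (zpow_pow_eq_one (g.root_pow hα) k) x = 0 := by
  obtain ⟨c, rfl⟩ := Ideal.mem_span_singleton.1 hx
  rw [map_mul]
  refine mul_eq_zero_of_left ((cycEval_eq_zero_iff g hα k _).2 ?_) _
  have hp := (reciprocal_mem g k).2.2
  refine ((reciprocal_mem g k).2.1.prime.dvd_or_dvd
    (hp.trans (prod_reciprocal_mul_div hr f S.toFinite.toFinset).symm.dvd)).resolve_left fun hd => ?_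
  obtain ⟨l, hl, hd⟩ := ((reciprocal_mem g k).2.1.prime.dvd_finsetProd_iff _).1 hd
  exact h l (S.toFinite.mem_toFinset.1 hl) (eq_of_irreducible_dvd (reciprocal_mem g _).2.1
    (reciprocal_mem f _).2.1 (reciprocal_mem g _).1 (reciprocal_mem f _).1 hd)

theorem reciprocal_ne_of_ne (hr : r ^ m ≡ 1 [ZMOD n]) {ω : ℕ} {f : Fin ω → Factor F n}
    (hf : IsOrbitReps hr f) {i j : Fin ω} (hij : i ≠ j) (k : Fin (orbitSize hr (f i)))
    (l : Fin (orbitSize hr (f j))) :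
    reciprocal (r ^ k.val) (f i).1 ≠ reciprocal (r ^ l.val) (f j).1 := fun h =>
  hij ((hf ⟨_, reciprocal_mem (f i) (r ^ k.val)⟩).unique ((mem_orbit_iff hr _ _).2 ⟨k, rfl⟩)
    ((mem_orbit_iff hr _ _).2 ⟨l, h⟩))

/-- The nonzeros of the codes lie in disjoint orbits. An element common to one code and the sum of
the others therefore vanishes at every root, so it is zero. -/
theorem iSupIndep_cyclicCode [Finite F] (hq : Nat.Coprime (Nat.card F) n)
    (hr : r ^ m ≡ 1 [ZMOD n]) {ω : ℕ} (f : Fin ω → Factor F n) (hf : IsOrbitReps hr f)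
    {K : Fin ω → Type*} [∀ i, Field (K i)] [∀ i, Algebra F (K i)] {α : ∀ i, K i}
    (hα : ∀ i, aeval (α i) (f i).1 = 0) (S : ∀ i, Set (Fin (orbitSize hr (f i)))) :
    iSupIndep fun i => cyclicCode hr (f i) (S i) := by
  intro i
  rw [disjoint_iff_inf_le]
  rintro x ⟨hxi, hx⟩
  refine mem_of_forall_cyclicCode_le hq hr f hf hα S ⊥ x fun j l hjl => (hjl ?_).elim
  rcases eq_or_ne j i with rfl | hji
  · have hle : (⨆ i, ⨆ (_ : i ≠ j), cyclicCode hr (f i) (S i)) ≤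
        RingHom.ker (cycEval F (α j ^ (r ^ l.val)) (zpow_pow_eq_one ((f j).root_pow (hα j)) _)) :=
      iSup₂_le fun i hij y hy => cycEval_eq_zero_of_mem_cyclicCode hr (f i) (f j) (hα j) (S i) _
        (fun k _ => reciprocal_ne_of_ne hr hf hij.symm l k) hy
    exact hle hx
  · exact cycEval_eq_zero_of_mem_cyclicCode hr (f i) (f j) (hα j) (S i) _
      (fun k _ => reciprocal_ne_of_ne hr hf hji l k) hxi

end CyclicCodes

/-! ### Coefficients in skew group algebras. -/

section SkewCoefficients

variable {F K G : Type*} [Field F] [Field K] [Algebra F K] [Group G] (θ : G →* (K ≃ₐ[F] K))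

/-- The coefficient of an element of `K *_θ G` at `g`, as an additive map. -/
noncomputable def SkewAlg.coeffHom (g : G) : SkewAlg θ →+ K where
  toFun x := SkewMonoidAlgebra.coeff (k := K) (G := G) x g
  map_zero' := rfl
  map_add' x y := DFunLike.congr_fun (SkewMonoidAlgebra.coeff_add (k := K) (G := G) x y) g

theorem SkewAlg.mem_support_iff (x : SkewAlg θ) (g : G) :
    g ∈ SkewMonoidAlgebra.support (x : SkewMonoidAlgebra K G) ↔ SkewAlg.coeffHom θ g x ≠ 0 :=
  SkewMonoidAlgebra.mem_support_iff

theorem SkewAlg.coeffHom_single_self (g : G) (c : K) :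
    SkewAlg.coeffHom θ g (SkewAlg.single θ g c) = c :=
  Finsupp.single_eq_same

theorem SkewAlg.coeffHom_single_of_ne {g g' : G} (h : g' ≠ g) (c : K) :
    SkewAlg.coeffHom θ g' (SkewAlg.single θ g c) = 0 :=
  Finsupp.single_eq_of_ne h

/-- The additive map `c ↦ c g`. -/
noncomputable def SkewAlg.singleHom (g : G) : K →+ SkewAlg θ where
  toFun := SkewAlg.single θ g
  map_zero' := SkewMonoidAlgebra.single_zero (k := K) (G := G) g
  map_add' := SkewMonoidAlgebra.single_add (k := K) (G := G) g

theorem SkewAlg.smul_single (c : F) (g : G) (x : K) :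
    c • SkewAlg.single θ g x = SkewAlg.single θ g (c • x) :=
  SkewMonoidAlgebra.smul_single (k := K) (G := G) c g x

theorem SkewAlg.single_one_one : SkewAlg.single θ 1 1 = 1 := rfl

theorem SkewAlg.single_one_mul_single (g : G) (c c' : K) :
    SkewAlg.single θ 1 c * SkewAlg.single θ g c' = SkewAlg.single θ g (c * c') := by
  rw [SkewAlg.single_mul_single, one_mul, map_one, AlgEquiv.one_apply]

theorem SkewAlg.single_one_pow (c : K) (k : ℕ) :
    SkewAlg.single θ 1 c ^ k = SkewAlg.single θ 1 (c ^ k) := by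
  induction k with
  | zero => rw [pow_zero, pow_zero, SkewAlg.single_one_one]
  | succ k ih => rw [pow_succ, ih, SkewAlg.single_one_mul_single, pow_succ]

end SkewCoefficients

/-! ### The entries of `τ P` in terms of the slices of `P`. -/

section Tau

variable {F : Type*} [Field F] {n m : ℕ} [NeZero n] [NeZero m] {r : ℤ}
  {K : Type*} [Field K] [Algebra F K] {α : K}

/-- The matrix is a cyclic shift that picks up a factor `h` at each wrap-around; the quotient counts
the wraps. -/
theorem matB_pow_apply (hr : r ^ m ≡ 1 [ZMOD n]) (f : Factor F n) (hα : IsRootField f α) (k : ℕ)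
    (j l : Fin (orbitSize hr f)) :
    (matB hr f hα ^ k) j l = if (j.val + k) % orbitSize hr f = l.val then
      SkewAlg.single _ (stabGen hr f ^ ((j.val + k) / orbitSize hr f)) 1 else 0 := by
  have hs := orbitSize_pos hr f
  induction k generalizing l with
  | zero =>
    rw [pow_zero, add_zero, Nat.mod_eq_of_lt j.2, Nat.div_eq_of_lt j.2, pow_zero,
      SkewAlg.single_one_one, Matrix.one_apply]
    simp only [Fin.ext_iff]
  | succ k ih =>
    rw [pow_succ, Matrix.mul_apply,
      Finset.sum_eq_single ⟨(j.val + k) % orbitSize hr f, Nat.mod_lt _ hs⟩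
        (fun p _ hp => by
          rw [ih, if_neg fun h => hp (Fin.ext h.symm), zero_mul])
        (fun h => (h (Finset.mem_univ _)).elim), ih, if_pos rfl, ← add_assoc]
    simp only [matB, Matrix.of_apply]
    have ht := Nat.mod_lt (j.val + k) hs
    have hdm := Nat.div_add_mod (j.val + k) (orbitSize hr f)
    set t := (j.val + k) % orbitSize hr f
    set Q := (j.val + k) / orbitSize hr f
    rcases Nat.lt_or_ge (t + 1) (orbitSize hr f) with h | h
    · have h1 := (Nat.div_mod_unique (a := j.val + k + 1) (c := t + 1) (d := Q) hs).2
        ⟨by omega, h⟩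
      rw [h1.1, h1.2]
      by_cases h2 : t + 1 = l.val
      · rw [if_pos h2, if_pos h2, mul_one]
      · rw [if_neg h2, if_neg h2, if_neg (by omega), mul_zero]
    -- Here `t + 1` equals the orbit size: the shift returns to column `0` and the quotient grows by
    -- one.
    · have h1 := (Nat.div_mod_unique (a := j.val + k + 1) (c := 0) (d := Q + 1) hs).2
        ⟨by rw [mul_add]; omega, hs⟩
      rw [h1.1, h1.2, if_neg (by have := l.2; omega)]
      by_cases h2 : 0 = l.val
      · rw [if_pos h2, if_pos ⟨by omega, h2.symm⟩, SkewAlg.single_mul_single, map_one, mul_one,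
          pow_succ]
      · rw [if_neg h2, if_neg (by omega), mul_zero]

theorem matA_pow_mul_matB_pow_apply (hr : r ^ m ≡ 1 [ZMOD n]) (f : Factor F n)
    (hα : IsRootField f α) (u k : ℕ) (j l : Fin (orbitSize hr f)) :
    (matA hr f hα ^ u * matB hr f hα ^ k) j l = if (j.val + k) % orbitSize hr f = l.val then
      SkewAlg.single _ (stabGen hr f ^ ((j.val + k) / orbitSize hr f)) ((α ^ (r ^ j.val)) ^ u)
      else 0 := by
  rw [matA, Matrix.diagonal_pow, Matrix.diagonal_mul, matB_pow_apply, Pi.pow_apply,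
    SkewAlg.single_one_pow]
  split_ifs
  · rw [SkewAlg.single_one_mul_single, mul_one]
  · rw [mul_zero]

/-- The factorisation `g = b ^ k * a ^ l` of the elements of the metacyclic group. -/
def factorEquiv (hr : r ^ m ≡ 1 [ZMOD n]) : Cyc m × Cyc n ≃ MetaGroup hr where
  toFun p := SemidirectProduct.inr p.1 * SemidirectProduct.inl p.2
  invFun g := (g.right, (twist hr g.right)⁻¹ g.left)
  left_inv p := by simp
  right_inv g := by
    refine SemidirectProduct.ext ?_ ?_
    · simp
    · simp

omit [NeZero n] in
theorem factorEquiv_left (hr : r ^ m ≡ 1 [ZMOD n]) (p : Cyc m × Cyc n) :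
    (factorEquiv hr p).left = twist hr p.1 p.2 := by
  simp [factorEquiv]

omit [NeZero n] in
theorem factorEquiv_right (hr : r ^ m ≡ 1 [ZMOD n]) (p : Cyc m × Cyc n) :
    (factorEquiv hr p).right = p.1 := by
  simp [factorEquiv]

/-- The coefficient `Q_y ∈ F[⟨a⟩]` in the expansion `P = ∑ y, y * Q_y` over `y ∈ ⟨b⟩`. -/
noncomputable def slice (hr : r ^ m ≡ 1 [ZMOD n]) (P : MonoidAlgebra F (MetaGroup hr))
    (y : Cyc m) : MonoidAlgebra F (Cyc n) :=
  .ofCoeff (Finsupp.equivFunOnFinite.symm fun v => P.coeff (factorEquiv hr (y, v)))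

theorem slice_coeff (hr : r ^ m ≡ 1 [ZMOD n]) (P : MonoidAlgebra F (MetaGroup hr))
    (y : Cyc m) (v : Cyc n) : (slice hr P y).coeff v = P.coeff (factorEquiv hr (y, v)) := rfl

theorem wt_eq_sum_slice (hr : r ^ m ≡ 1 [ZMOD n]) (P : MonoidAlgebra F (MetaGroup hr)) :
    wt P = ∑ y, wt (slice hr P y) := by
  classical
  have hcard : ∀ {G : Type} [Fintype G] (u : MonoidAlgebra F G),
      wt u = ∑ g, if u.coeff g ≠ 0 then 1 else 0 := by
    intro G _ u
    rw [wt, ← Finset.card_filter]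
    congr 1
    ext g
    simp
  let : Fintype (MetaGroup hr) := Fintype.ofEquiv _ (factorEquiv hr)
  simp only [hcard]
  rw [← (factorEquiv hr).sum_comp, Fintype.sum_prod_type]
  rfl

/-- Moving `b ^ k` past a power of `a` multiplies its exponent by `r ^ k` modulo `n`, which shifts
the evaluation point from `r ^ j` to `r ^ (j + k)`. -/
theorem pow_twist_val (hr : r ^ m ≡ 1 [ZMOD n]) {β : K} (hβ : β ^ n = 1) (j : ℕ) (y : Cyc m)
    (v : Cyc n) :
    (β ^ (r ^ j)) ^ (Multiplicative.toAdd (twist hr y v)).val =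
      (β ^ (r ^ (j + (Multiplicative.toAdd y).val))) ^ (Multiplicative.toAdd v).val := by
  rw [← zpow_natCast, ← zpow_natCast, ← zpow_mul, ← zpow_mul]
  refine zpow_congr hβ ((ZMod.intCast_eq_intCast_iff _ _ n).1 ?_)
  have h : Multiplicative.toAdd (twist hr y v) =
      ((unitOf hr ^ (Multiplicative.toAdd y).val : (ZMod n)ˣ) : ZMod n) *
        Multiplicative.toAdd v := rfl
  have hu : ((unitOf hr : (ZMod n)ˣ) : ZMod n) = r := rfl
  rw [h, Units.val_pow_eq_pow_val, hu]
  push_cast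
  rw [ZMod.natCast_zmod_val, ZMod.natCast_zmod_val, pow_add, mul_assoc]

theorem tau_apply (hr : r ^ m ≡ 1 [ZMOD n]) (f : Factor F n) (hα : IsRootField f α)
    (P : MonoidAlgebra F (MetaGroup hr)) (j l : Fin (orbitSize hr f)) :
    tau hr f hα P j l = ∑ y : Cyc m,
      if (j.val + (Multiplicative.toAdd y).val) % orbitSize hr f = l.val then
        SkewAlg.single _
          (stabGen hr f ^ ((j.val + (Multiplicative.toAdd y).val) / orbitSize hr f))
          (cycEval F (α ^ (r ^ (j.val + (Multiplicative.toAdd y).val)))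
            (zpow_pow_eq_one (f.root_pow hα.1) _) (slice hr P y))
      else 0 := by
  let : Fintype (MetaGroup hr) := Fintype.ofEquiv _ (factorEquiv hr)
  have hsum : tau hr f hα P = ∑ y, ∑ v, P.coeff (factorEquiv hr (y, v)) •
      (matA hr f hα ^ (Multiplicative.toAdd (factorEquiv hr (y, v)).left).val *
        matB hr f hα ^ (Multiplicative.toAdd (factorEquiv hr (y, v)).right).val) := by
    rw [tau, Finsupp.sum_fintype _ _ (fun g => by rw [zero_smul]), ← (factorEquiv hr).sum_comp, Fintype.sum_prod_type]
  rw [hsum, Matrix.sum_apply]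
  refine Finset.sum_congr rfl fun y _ => ?_
  rw [Matrix.sum_apply]
  simp only [Matrix.smul_apply, matA_pow_mul_matB_pow_apply, factorEquiv_left, factorEquiv_right]
  split_ifs
  · rw [cycEval_apply]
    refine Eq.trans ?_ (map_sum (SkewAlg.singleHom (theta hr f hα) _) _ _).symm
    refine Finset.sum_congr rfl fun v _ => ?_
    rw [SkewAlg.smul_single, pow_twist_val hr (f.root_pow hα.1)]
    rfl
  · simp only [smul_zero, Finset.sum_const_zero]

theorem coordWt_tau_le [DecidableEq (MonoidAlgebra F (Cyc n))] (hr : r ^ m ≡ 1 [ZMOD n])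
    (f : Factor F n) (hα : IsRootField f α) (P : MonoidAlgebra F (MetaGroup hr))
    (j : Fin (orbitSize hr f)) :
    coordWt (tau hr f hα P j) ≤ (Finset.univ.filter fun y => slice hr P y ≠ 0).card := by
  classical
  have hs := orbitSize_pos hr f
  -- The nonzero slices are sorted by the column to which they contribute; the bound is then proved
  -- column by column.
  rw [Finset.card_eq_sum_card_fiberwise (t := Finset.univ)
    (f := fun y => (⟨(j.val + (Multiplicative.toAdd y).val) % orbitSize hr f,
      Nat.mod_lt _ hs⟩ : Fin (orbitSize hr f))) (fun _ _ => Finset.mem_coe.2 (Finset.mem_univ _))]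
  refine Finset.sum_le_sum fun l _ => ?_
  refine le_trans (Finset.card_le_card ?_) (Finset.card_image_le (f := fun y : Cyc m =>
    stabGen hr f ^ ((j.val + (Multiplicative.toAdd y).val) / orbitSize hr f)))
  intro x hx
  rw [SkewAlg.mem_support_iff, tau_apply, map_sum] at hx
  obtain ⟨y, -, hy⟩ := Finset.exists_ne_zero_of_sum_ne_zero hx
  split_ifs at hy with h
  · refine Finset.mem_image.2 ⟨y, Finset.mem_filter.2 ⟨Finset.mem_filter.2 ⟨Finset.mem_univ _, ?_⟩,
      Fin.ext h⟩, ?_⟩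
    · intro h0
      rw [h0, map_zero] at hy
      exact hy (by rw [show SkewAlg.single (theta hr f hα) _ (0 : K) = 0 from
        (SkewAlg.singleHom _ _).map_zero, map_zero])
    · by_contra hne
      exact hy (SkewAlg.coeffHom_single_of_ne _ (Ne.symm hne) _)
  · exact (hy (map_zero _)).elim

/-- Division with remainder gives `b ^ j * y = h ^ quotient * b ^ remainder`, so column and group
element together recover `y`. -/
theorem eq_of_stabGen_pow_eq (hr : r ^ m ≡ 1 [ZMOD n]) (f : Factor F n) (j : ℕ) {x y : Cyc m}
    (hmod : (j + (Multiplicative.toAdd x).val) % orbitSize hr f =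
      (j + (Multiplicative.toAdd y).val) % orbitSize hr f)
    (hdiv : stabGen hr f ^ ((j + (Multiplicative.toAdd x).val) / orbitSize hr f) =
      stabGen hr f ^ ((j + (Multiplicative.toAdd y).val) / orbitSize hr f)) : x = y := by
  have h : ∀ z : Cyc m, gen m ^ j * z =
      ((stabGen hr f ^ ((j + (Multiplicative.toAdd z).val) / orbitSize hr f) : stab hr f) : Cyc m) *
        gen m ^ ((j + (Multiplicative.toAdd z).val) % orbitSize hr f) := by
    intro z
    have h1 : ((stabGen hr f : stab hr f) : Cyc m) = gen m ^ orbitSize hr f := rfl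
    rw [Subgroup.coe_pow, h1, ← pow_mul, ← pow_add, Nat.div_add_mod, pow_add, gen_pow_val]
  have hxy := h x
  rw [hmod, hdiv, ← h y] at hxy
  exact mul_left_cancel hxy

/-- No cancellation occurs: only one `y` contributes to a given coordinate of a row. -/
theorem tau_apply_ne_zero (hr : r ^ m ≡ 1 [ZMOD n]) (f : Factor F n) (hα : IsRootField f α)
    (P : MonoidAlgebra F (MetaGroup hr)) (j l : Fin (orbitSize hr f)) (y : Cyc m)
    (hl : (j.val + (Multiplicative.toAdd y).val) % orbitSize hr f = l.val)
    (hy : cycEval F (α ^ (r ^ (j.val + (Multiplicative.toAdd y).val)))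
      (zpow_pow_eq_one (f.root_pow hα.1) _) (slice hr P y) ≠ 0) :
    tau hr f hα P j l ≠ 0 := by
  intro h0
  have h1 := congrArg (SkewAlg.coeffHom (theta hr f hα)
    (stabGen hr f ^ ((j.val + (Multiplicative.toAdd y).val) / orbitSize hr f))) h0
  rw [tau_apply, map_sum, map_zero, Finset.sum_eq_single y, if_pos hl,
    SkewAlg.coeffHom_single_self] at h1
  · exact hy h1
  · intro x _ hxy
    split_ifs with hx
    · exact SkewAlg.coeffHom_single_of_ne _
        (fun h => hxy (eq_of_stabGen_pow_eq hr f j.val (hx.trans hl.symm) h.symm)) _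
    · exact map_zero _
  · exact fun h => (h (Finset.mem_univ _)).elim

/-- If the slice `Q_y` of `P` does not vanish at `α ^ (r ^ l)`, some row of `τ P` has a nonzero
entry in the column `l`. -/
theorem exists_tau_apply_ne_zero (hr : r ^ m ≡ 1 [ZMOD n]) (f : Factor F n)
    (hα : IsRootField f α) (P : MonoidAlgebra F (MetaGroup hr)) (l : Fin (orbitSize hr f))
    (y : Cyc m) (hy : cycEval F (α ^ (r ^ l.val)) (zpow_pow_eq_one (f.root_pow hα.1) _)
      (slice hr P y) ≠ 0) : ∃ j, tau hr f hα P j l ≠ 0 := by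
  have hs := orbitSize_pos hr f
  set k := (Multiplicative.toAdd y).val with hk
  have hj : ∃ j < orbitSize hr f, (j + k) % orbitSize hr f = l.val := by
    have hks := Nat.mod_lt k hs
    -- The row is `l - k` modulo the orbit size, written so that the natural subtraction does not
    -- truncate.
    refine ⟨(l.val + (orbitSize hr f - k % orbitSize hr f)) % orbitSize hr f, Nat.mod_lt _ hs, ?_⟩
    rw [Nat.mod_add_mod, ← Nat.add_mod_mod, add_assoc, Nat.sub_add_cancel hks.le,
      Nat.add_mod_right, Nat.mod_eq_of_lt l.2]
  obtain ⟨j, hjs, hjl⟩ := hj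
  refine ⟨⟨j, hjs⟩, tau_apply_ne_zero hr f hα P ⟨j, hjs⟩ l y hjl fun h0 => hy ?_⟩
  rw [← cycEval_eq_zero_iff_of_reciprocal_eq f hα.1 ?_] at h0
  · exact h0
  · rw [← reciprocal_pow_mod hr f (j + _), hjl]

end Tau

/-! ### Weight counting and the lower bound. -/

theorem minDist_le {M : Type*} [AddGroup M] (w : M → ℕ) {C : Set M} (h0 : (0 : M) ∈ C) {x : M}
    (hx : x ∈ C) (hne : x ≠ 0) : minDist w C ≤ w x := by
  have h : minDist w C ≤ (w (x - 0) : ℕ∞) :=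
    iInf₂_le_of_le x hx (iInf₂_le_of_le 0 h0 (iInf_le_of_le hne le_rfl))
  rwa [sub_zero] at h

theorem codeDist_le {F G : Type*} [Field F] [Group G] {C : Ideal (MonoidAlgebra F G)}
    {x : MonoidAlgebra F G} (hx : x ∈ C) (hne : x ≠ 0) : codeDist C ≤ wt x :=
  minDist_le wt C.zero_mem hx hne

theorem card_mul_codeDist_le_wt {F : Type*} [Field F] {n m : ℕ} [NeZero n] [NeZero m] {r : ℤ}
    [DecidableEq (MonoidAlgebra F (Cyc n))] (hr : r ^ m ≡ 1 [ZMOD n])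
    (P : MonoidAlgebra F (MetaGroup hr)) {J : Ideal (MonoidAlgebra F (Cyc n))}
    (hJ : ∀ y, slice hr P y ∈ J) :
    ((Finset.univ.filter fun y => slice hr P y ≠ 0).card : ℕ∞) * codeDist J ≤ wt P := by
  -- If every slice is zero, the left side is `0` even when the distance is `⊤`.
  calc _ ≤ ∑ y ∈ Finset.univ.filter (fun y => slice hr P y ≠ 0), (wt (slice hr P y) : ℕ∞) := by
        rw [← nsmul_eq_mul]
        exact Finset.card_nsmul_le_sum _ _ _ fun y hy =>
          codeDist_le (hJ y) (Finset.mem_filter.1 hy).2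
    _ ≤ ∑ y, (wt (slice hr P y) : ℕ∞) :=
        Finset.sum_le_sum_of_subset (Finset.filter_subset _ _)
    _ = wt P := by rw [wt_eq_sum_slice, Nat.cast_sum]

end Metacyclic

theorem theorem3 {F : Type*} [Field F] [Finite F] {n m : ℕ} [NeZero n] [NeZero m] {r : ℤ}
    (hq : Nat.Coprime (Nat.card F) n) (hr : r ^ m ≡ 1 [ZMOD n])
    {ω : ℕ} (f : Fin ω → Factor F n) (hf : IsOrbitReps hr f)
    (K : Fin ω → Type*) [∀ i, Field (K i)] [∀ i, Algebra F (K i)]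
    (α : ∀ i, K i) (hα : ∀ i, IsRootField (f i) (α i))
    (C : Ideal (MonoidAlgebra F (MetaGroup hr)))
    (L : ∀ i, Submodule (CoeffRing hr (f i) (hα i))
      (Fin (orbitSize hr (f i)) → CoeffRing hr (f i) (hα i)))
    (hL : ∀ i, L i = component hr (f i) (hα i) C)
    (V : Fin ω → Ideal (MonoidAlgebra F (Cyc n)))
    (hV : ∀ i, V i = cyclicCode hr (f i) (suppSubmodule (L i)))
    (d : Fin ω → ℕ∞) (hd : ∀ i, d i = coordDist (L i))
    {N : ℕ} (e : Fin N ≃ {i : Fin ω // L i ≠ ⊥}) (he : Monotone fun j => d (e j)) :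
    iSupIndep (fun j => V (e j)) ∧
      (⨅ j : Fin N, d (e j) * codeDist (⨆ k ≤ j, V (e k))) ≤ codeDist C := by
  classical
  obtain rfl : V = fun i => cyclicCode hr (f i) (suppSubmodule (L i)) := funext hV
  have hind : iSupIndep fun i => cyclicCode hr (f i) (suppSubmodule (L i)) :=
    iSupIndep_cyclicCode hq hr f hf (fun i => (hα i).1) fun i => suppSubmodule (L i)
  have hinj : Function.Injective fun j => (e j : Fin ω) :=
    Subtype.val_injective.comp e.injective
  refine ⟨hind.comp hinj, ?_⟩
  refine le_iInf₂ fun P₁ h₁ => le_iInf₂ fun P₂ h₂ => le_iInf fun hne => ?_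
  have hP : P₁ - P₂ ∈ C := C.sub_mem h₁ h₂
  have hP0 : P₁ - P₂ ≠ 0 := sub_ne_zero.2 hne
  generalize P₁ - P₂ = P at hP hP0
  let Nonvanishing (i : Fin ω) (l : Fin (orbitSize hr (f i))) (y : Cyc m) : Prop :=
    cycEval F (α i ^ (r ^ l.val)) (zpow_pow_eq_one ((f i).root_pow (hα i).1) _) (slice hr P y) ≠ 0
  have hrow : ∀ i j, tau hr (f i) (hα i) P j ∈ L i := fun i j => by
    rw [hL i]
    exact Submodule.subset_span ⟨P, hP, j, rfl⟩
  have hsupp : ∀ i l y, Nonvanishing i l y → l ∈ suppSubmodule (L i) := fun i l y h => by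
    obtain ⟨j, hj⟩ := exists_tau_apply_ne_zero hr (f i) (hα i) P l y h
    exact ⟨_, hrow i j, hj⟩
  have hbot : ∀ i l y, Nonvanishing i l y → L i ≠ ⊥ := fun i l y h h0 => by
    obtain ⟨x, hx, hxl⟩ := hsupp i l y h
    rw [h0, Submodule.mem_bot] at hx
    exact hxl (congrFun hx l)
  -- The nonzero row found in `L i` has weight at least `d i` and at most the number of nonzero
  -- slices.
  have hdist : ∀ i l y, Nonvanishing i l y →
      d i ≤ ((Finset.univ.filter fun y => slice hr P y ≠ 0).card : ℕ∞) := fun i l y h => by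
    obtain ⟨j, hj⟩ := exists_tau_apply_ne_zero hr (f i) (hα i) P l y h
    rw [hd i]
    exact (minDist_le coordWt (L i).zero_mem (hrow i j) fun h0 => hj (congrFun h0 l)).trans
      (Nat.cast_le.2 (coordWt_tau_le hr (f i) (hα i) P j))
  -- The positions in the enumeration whose component sees some slice of `P`.
  let T : Finset (Fin N) := Finset.univ.filter fun j => ∃ l y, Nonvanishing (e j) l y
  have hT : ∀ i l y, Nonvanishing i l y → ∃ j ∈ T, (e j : Fin ω) = i := fun i l y h => by
    have hi : ((e (e.symm ⟨i, hbot i l y h⟩) : {i // L i ≠ ⊥}) : Fin ω) = i := by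
      rw [Equiv.apply_symm_apply]
    refine ⟨_, Finset.mem_filter.2 ⟨Finset.mem_univ _, ?_⟩, hi⟩
    rw [hi]
    exact ⟨l, y, h⟩
  -- Otherwise all slices vanish at all roots of unity and `P = 0`. This also disposes of the empty
  -- minimum, `N = 0`.
  have hTne : T.Nonempty := by
    by_contra hemp
    rw [Finset.not_nonempty_iff_eq_empty] at hemp
    have hslice : ∀ y, slice hr P y = 0 := fun y => by
      refine mem_of_forall_cyclicCode_le hq hr f hf (fun i => (hα i).1)
        (fun i => suppSubmodule (L i)) ⊥ _ fun i l h => ?_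
      obtain ⟨j, hj, -⟩ := hT i l y h
      simp [hemp] at hj
    refine hP0 (MonoidAlgebra.ext (Finsupp.ext fun g => ?_))
    obtain ⟨⟨y, v⟩, rfl⟩ := (factorEquiv hr).surjective g
    rw [← slice_coeff, hslice y]
    rfl
  obtain ⟨j₀, hj₀, hmax⟩ : ∃ j₀ ∈ T, ∀ j ∈ T, j ≤ j₀ := ⟨T.max' hTne, T.max'_mem _, T.le_max'⟩
  obtain ⟨l₀, y₀, h₀⟩ := (Finset.mem_filter.1 hj₀).2
  refine (iInf_le _ j₀).trans ?_
  -- By maximality of `j₀`, every root at which a slice is nonzero belongs to a code with index at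
  -- most `j₀`.
  have hmem : ∀ y, slice hr P y ∈
      ⨆ k ≤ j₀, cyclicCode hr (f (e k)) (suppSubmodule (L (e k))) := fun y => by
    refine mem_of_forall_cyclicCode_le hq hr f hf (fun i => (hα i).1)
      (fun i => suppSubmodule (L i)) _ _ fun i l h => ⟨?_, hsupp i l y h⟩
    obtain ⟨j, hj, rfl⟩ := hT i l y h
    exact le_iSup₂_of_le j (hmax j hj) le_rfl
  exact (mul_le_mul_left (hdist _ l₀ y₀ h₀) _).trans (card_mul_codeDist_le_wt hr P hmem)
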